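/- Let $\omega$ be the set of natural numbers, let $\mathfrak{c}=2^{\aleph_0}$, and let $\mathfrak{d}$ be the minimal size of a family $\mathcal{F}\subseteq\omega^\omega$ such that for every $f\in\omega^\omega$ there exists $g\in\mathcal{F}$ with $f(n)\leq g(n)$ for all but finitely many $n$. For $x\subseteq\omega$ put $x^0=\omega\setminus x$ and $x^1=x$. An independent family on $\omega$ is a collection $\mathcal{A}$ of subsets of $\omega$ such that $\bigcap_{x\in F}x^{\nu(x)}$ is infinite for every non-empty finite $F\subseteq\mathcal{A}$ and every $\nu:F\to\{0,1\}$. A topological space is completely Baire if each of its closed subspaces is a Baire space (that is, countable intersections of dense open sets are dense in it). Subsets of $\omega$ are identified with their characteristic functions, so that a collection of subsets of $\omega$ is a subspace of the Cantor space $2^\omega$. Assume $\mathfrak{d}=\mathfrak{c}$. Then there exists an independent family $\mathcal{A}$ on $\omega$ that is dense in $2^\omega$ and completely Baire (as a subspace of $2^\omega$). -/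

import Mathlib

/-- A family `F` of functions `ω → ω` is dominating if every `f : ω → ω` is bounded by some
`g ∈ F` at all but finitely many arguments. -/
def IsDominating (F : Set (ℕ → ℕ)) : Prop :=
  ∀ f : ℕ → ℕ, ∃ g ∈ F, ∀ᶠ n in Filter.atTop, f n ≤ g n

/-- The dominating number `𝔡`: the minimal size of a dominating family. -/
noncomputable def dominatingNumber : Cardinal.{0} :=
  sInf {κ | ∃ F : Set (ℕ → ℕ), IsDominating F ∧ Cardinal.mk F = κ}

/-- The set over which the infimum `𝔡` is taken is nonempty, so `𝔡` is a genuine minimum. -/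
theorem exists_mk_eq_dominatingNumber :
    ∃ F : Set (ℕ → ℕ), IsDominating F ∧ Cardinal.mk F = dominatingNumber :=
  csInf_mem (s := {κ | ∃ F : Set (ℕ → ℕ), IsDominating F ∧ Cardinal.mk F = κ})
    ⟨_, Set.univ, fun f => ⟨f, Set.mem_univ f, Filter.Eventually.of_forall fun _ => le_rfl⟩, rfl⟩

/-- For `x ⊆ I`: `x ^ 1 = x` and `x ^ 0 = I \ x`, where `true` stands for `1` and `false`
for `0`. -/
def signedSet {I : Type*} (x : Set I) : Bool → Set I
  | true => x
  | false => xᶜ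

/-- `A` is an independent family on `I`: for every nonempty finite `F ⊆ A` and every
`ν : F → 2`, the set `⋂ x ∈ F, x ^ ν(x)` is infinite. -/
def IsIndependentFamily {I : Type*} (A : Set (Set I)) : Prop :=
  ∀ F : Finset (Set I), (F : Set (Set I)) ⊆ A → F.Nonempty →
    ∀ ν : {x // x ∈ F} → Bool, (⋂ x : {x // x ∈ F}, signedSet x.1 (ν x)).Infinite

open Classical in
/-- The characteristic function of `x ⊆ I`, as a point of `2 ^ I = (I → Bool)`
(with the product topology). -/
noncomputable def charFun {I : Type*} (x : Set I) : I → Bool :=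
  fun i => decide (i ∈ x)

/-- A topological space is completely Baire if every closed subspace of it is a Baire space. -/
def IsCompletelyBaire (X : Type*) [TopologicalSpace X] : Prop :=
  ∀ C : Set X, IsClosed C → BaireSpace C

/-! If a closed subspace `C` of `A` is not Baire, some nonempty open `V` in `C` misses the
intersection of dense open sets `U n`. Then no point of `V` is isolated, so `V` contains a scheme: a
tree of points of `C` indexed by finite sequences, where the successors of each node converge to it
and nodes of length `n + 1` carry balls inside `U n`. Every branch, if it lies in `A`, lies in `C`,
in `V` and in all `U n`, a contradiction. Hence it suffices that every scheme with nodes in `A` has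
a branch in `A` (`isCompletelyBaire_of_branches`).

There are only `𝔠` schemes, so such an `A` arises from a countable dense independent family by
adding one branch per stage. To keep independence, the branch must split fewer than `𝔠` Boolean
combinations. Each of these is split by all but finitely many nodes, and a branch inherits this if
it follows its nodes far enough infinitely often. Since `𝔡 = 𝔠`, one sequence is fast enough for all
of them at once (`exists_frequently_lt_of_mk_lt`, `IsScheme.exists_isBranch_splits`). -/

open Filter Set

/-! ### Functions escaping fewer than `𝔡` many bounds -/

/-- The list of the first `n` values of `f`, the latest value first. -/
def initialList (f : ℕ → ℕ) : ℕ → List ℕ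
  | 0 => []
  | n + 1 => f n :: initialList f n

theorem length_initialList (f : ℕ → ℕ) (n : ℕ) : (initialList f n).length = n := by
  induction n with
  | zero => rfl
  | succ n ih => simp [initialList, ih]

theorem mem_initialList {f : ℕ → ℕ} {n a : ℕ} (h : a ∈ initialList f n) : ∃ j < n, f j = a := by
  induction n with
  | zero => simp [initialList] at h
  | succ n ih =>
    rcases List.mem_cons.1 h with rfl | h
    · exact ⟨n, n.lt_succ_self, rfl⟩
    · obtain ⟨j, hj, e⟩ := ih h
      exact ⟨j, hj.trans n.lt_succ_self, e⟩

theorem exists_bound_on_lists (h : List ℕ → ℕ) (n k : ℕ) :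
    ∃ b, ∀ s : List ℕ, s.length = n → (∀ a ∈ s, a ≤ k) → h s ≤ b := by
  have hfin : {s : List ℕ | s.length = n ∧ ∀ a ∈ s, a ≤ k}.Finite := by
    refine ((List.finite_length_eq (Fin (k + 1)) n).image (List.map Fin.val)).subset ?_
    rintro s ⟨hs, hk⟩
    refine ⟨s.attach.map fun a => ⟨a.1, Nat.lt_succ_of_le (hk a.1 a.2)⟩, by simpa using hs, ?_⟩
    simp [List.map_map, Function.comp_def]
  obtain ⟨b, hb⟩ := (hfin.image h).bddAbove
  exact ⟨b, fun s hs hk => hb ⟨s, ⟨hs, hk⟩, rfl⟩⟩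

/-- Once the first `n` values are bounded, only finitely many initial lists are possible, so `h` is
bounded on them and `b` can be defined by recursion. -/
theorem exists_bound_of_le_initialList (h : List ℕ → ℕ) (M : ℕ) :
    ∃ b : ℕ → ℕ, ∀ f : ℕ → ℕ, (∀ n, f n ≤ M ∨ f n ≤ h (initialList f n)) → ∀ n, f n ≤ b n := by
  choose c hc using exists_bound_on_lists h
  let b : ℕ → ℕ := fun n => Nat.rec (M + h []) (fun n r => r + c (n + 1) r) n
  have hb : ∀ n, b (n + 1) = b n + c (n + 1) (b n) := fun n => rfl
  have hmono : Monotone b := monotone_nat_of_le_succ fun n => by rw [hb]; omega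
  refine ⟨b, fun f hf n => ?_⟩
  have hM : ∀ n, M ≤ b n := fun n =>
    (Nat.le_add_right M (h [])).trans (hmono (Nat.zero_le n))
  induction n using Nat.strong_induction_on with
  | _ n ih =>
    rcases hf n with hn | hn
    · exact hn.trans (hM n)
    · cases n with
      | zero => exact hn.trans (Nat.le_add_left _ _)
      | succ n =>
        refine hn.trans ((hc (n + 1) (b n) _ (length_initialList _ _) fun a ha => ?_).trans ?_)
        · obtain ⟨j, hj, rfl⟩ := mem_initialList ha
          exact (ih j hj).trans (hmono (Nat.le_of_lt_succ hj))
        · rw [hb]; omega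

theorem exists_frequently_lt_of_mk_lt (hd : dominatingNumber = Cardinal.continuum) {ι : Type}
    (hι : Cardinal.mk ι < Cardinal.continuum) (h : ι → List ℕ → ℕ) :
    ∃ f : ℕ → ℕ, ∀ i, ∃ᶠ n in atTop, h i (initialList f n) < f n := by
  choose b hb using fun p : ι × ℕ => exists_bound_of_le_initialList (h p.1) p.2
  have hcard : Cardinal.mk (range b) < Cardinal.continuum := by
    refine Cardinal.mk_range_le.trans_lt ?_
    rw [Cardinal.mk_prod, Cardinal.lift_id, Cardinal.lift_id]
    exact Cardinal.mul_lt_of_lt Cardinal.aleph0_le_continuum hι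
      (by simpa using Cardinal.aleph0_lt_continuum)
  have hnd : ¬ IsDominating (range b) := fun hD => by
    have : dominatingNumber ≤ Cardinal.mk (range b) := csInf_le' ⟨_, hD, rfl⟩
    exact absurd hcard (not_lt.2 (hd ▸ this))
  unfold IsDominating at hnd
  push Not at hnd
  obtain ⟨f, hf⟩ := hnd
  refine ⟨f, fun i => ?_⟩
  by_contra hcon
  simp only [not_frequently, not_lt, eventually_atTop] at hcon
  obtain ⟨m, hm⟩ := hcon
  -- The constant `M` absorbs the finitely many values of `f` before `m`.
  refine hf _ ⟨(i, (Finset.range m).sup f), rfl⟩ (Eventually.of_forall fun n => not_lt.2 ?_)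
  revert n
  refine hb (i, (Finset.range m).sup f) f fun n => ?_
  rcases lt_or_ge n m with hn | hn
  · exact Or.inl (Finset.le_sup (f := f) (Finset.mem_range.2 hn))
  · exact Or.inr (hm n hn)

/-! ### Branching schemes of subsets of `ω` -/

/-- `x` and `y` have the same elements below `k`. -/
def AgreeBelow (k : ℕ) (x y : Set ℕ) : Prop :=
  ∀ i < k, i ∈ x ↔ i ∈ y

theorem AgreeBelow.symm {k : ℕ} {x y : Set ℕ} (h : AgreeBelow k x y) : AgreeBelow k y x :=
  fun i hi => (h i hi).symm

theorem AgreeBelow.trans {k : ℕ} {x y z : Set ℕ} (h : AgreeBelow k x y) (h' : AgreeBelow k y z) :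
    AgreeBelow k x z :=
  fun i hi => (h i hi).trans (h' i hi)

theorem AgreeBelow.mono {k m : ℕ} {x y : Set ℕ} (h : AgreeBelow k x y) (hm : m ≤ k) :
    AgreeBelow m x y :=
  fun i hi => h i (hi.trans_le hm)

/-- A family of subsets of `ω` indexed by the finite sequences of naturals in which the successors
of every node converge to it, without being equal to it; `l` measures how close the nodes are. -/
structure IsScheme (q : List ℕ → Set ℕ) (l : List ℕ → ℕ) : Prop where
  agree : ∀ s k, AgreeBelow (max (l s) k) (q (k :: s)) (q s)
  not_agree : ∀ s k, ¬ AgreeBelow (l (k :: s)) (q (k :: s)) (q s)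
  lt : ∀ s k, max (l s) k < l (k :: s)

/-- `x` is the limit of the scheme `(q, l)` along some infinite sequence of naturals. -/
def IsBranch (q : List ℕ → Set ℕ) (l : List ℕ → ℕ) (x : Set ℕ) : Prop :=
  ∃ f : ℕ → ℕ, ∀ n, AgreeBelow (max (l (initialList f n)) (f n)) x (q (initialList f n))

namespace IsScheme

variable {q : List ℕ → Set ℕ} {l : List ℕ → ℕ}

theorem le_level (hq : IsScheme q l) (f : ℕ → ℕ) (n : ℕ) : n ≤ l (initialList f n) := by
  induction n with
  | zero => exact Nat.zero_le _
  | succ n ih =>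
    have := hq.lt (initialList f n) (f n)
    have h2 : l (initialList f n) < l (f n :: initialList f n) := (le_max_left _ _).trans_lt this
    change n + 1 ≤ l (f n :: initialList f n)
    omega

theorem agree_of_le (hq : IsScheme q l) (f : ℕ → ℕ) {n m : ℕ} (hnm : n ≤ m) :
    AgreeBelow (max (l (initialList f n)) (f n)) (q (initialList f m)) (q (initialList f n)) ∧
      l (initialList f n) ≤ l (initialList f m) ∧
      (n < m → max (l (initialList f n)) (f n) ≤ l (initialList f m)) := by
  induction m, hnm using Nat.le_induction with
  | base => exact ⟨fun _ _ => Iff.rfl, le_rfl, fun h => absurd h (lt_irrefl _)⟩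
  | succ m hm ih =>
    obtain ⟨h1, h2, h3⟩ := ih
    have hl := hq.lt (initialList f m) (f m)
    have ha := hq.agree (initialList f m) (f m)
    change AgreeBelow _ (q (f m :: initialList f m)) _ ∧ _ ≤ l (f m :: initialList f m) ∧
      (_ → _ ≤ l (f m :: initialList f m))
    have hle : max (l (initialList f n)) (f n) ≤ max (l (initialList f m)) (f m) := by
      rcases hm.eq_or_lt with rfl | hlt
      · exact le_rfl
      · exact (h3 hlt).trans (le_max_left _ _)
    exact ⟨(ha.mono hle).trans h1, (le_max_left _ _).trans (hle.trans hl.le),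
      fun _ => hle.trans hl.le⟩

/-- A node differs from its successor below the successor's level, and all later nodes agree with
the successor there. -/
theorem injective_along (hq : IsScheme q l) (f : ℕ → ℕ) :
    Function.Injective fun n => q (initialList f n) := by
  refine Function.Injective.of_lt_imp_ne fun n m hnm h => ?_
  have h1 := (hq.agree_of_le f (Nat.succ_le_of_lt hnm)).1.mono (le_max_left _ _)
  refine hq.not_agree (initialList f n) (f n) ?_
  have h' : q (initialList f n) = q (initialList f m) := h
  rw [h']
  exact h1.symm

theorem exists_limit (hq : IsScheme q l) (f : ℕ → ℕ) :
    ∃ x, ∀ n, AgreeBelow (max (l (initialList f n)) (f n)) x (q (initialList f n)) := by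
  -- Levels grow at least by one, so membership of `i` is settled from node `i + 1` on.
  refine ⟨{i | i ∈ q (initialList f (i + 1))}, fun n i hi => ?_⟩
  change i ∈ q (initialList f (i + 1)) ↔ _
  rcases le_total n (i + 1) with hn | hn
  · exact (hq.agree_of_le f hn).1 i hi
  · refine ((hq.agree_of_le f hn).1 i ?_).symm
    exact lt_of_lt_of_le (hq.le_level f (i + 1)) (le_max_left _ _)

end IsScheme

/-- `x` splits `w` into two infinite pieces. -/
def Splits (x w : Set ℕ) : Prop :=
  (w ∩ x).Infinite ∧ (w \ x).Infinite

theorem IsScheme.exists_isBranch_splits (hd : dominatingNumber = Cardinal.continuum)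
    {q : List ℕ → Set ℕ} {l : List ℕ → ℕ} (hq : IsScheme q l) {W : Set (Set ℕ)}
    (hW : Cardinal.mk W < Cardinal.continuum)
    (hfin : ∀ w ∈ W, {x | x ∈ range q ∧ ¬ Splits x w}.Finite) :
    ∃ x, IsBranch q l x ∧ ∀ w ∈ W, Splits x w := by
  -- Below `k` the node shows an element of `w` inside it and one outside it, both at least
  -- `s.length`. If `f n` exceeds this `k`, the limit agrees with the node on both.
  have key : ∀ (w : W) (s : List ℕ), ∃ k, Splits (q s) w →
      (∃ i, s.length ≤ i ∧ i < k ∧ i ∈ w.1 ∩ q s) ∧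
        ∃ i, s.length ≤ i ∧ i < k ∧ i ∈ w.1 \ q s := by
    intro w s
    by_cases hs : Splits (q s) w
    · obtain ⟨i, hi, hi'⟩ := hs.1.exists_gt s.length
      obtain ⟨j, hj, hj'⟩ := hs.2.exists_gt s.length
      exact ⟨i + j + 1, fun _ => ⟨⟨i, hi'.le, by omega, hi⟩, ⟨j, hj'.le, by omega, hj⟩⟩⟩
    · exact ⟨0, fun h => absurd h hs⟩
  choose h hh using key
  obtain ⟨f, hf⟩ := exists_frequently_lt_of_mk_lt hd hW h
  obtain ⟨x, hx⟩ := hq.exists_limit f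
  refine ⟨x, ⟨f, hx⟩, fun w hw => ?_⟩
  have hev : ∀ᶠ n in atTop, Splits (q (initialList f n)) w := by
    -- The nodes along `f` are distinct, so only finitely many of them can fail to split `w`.
    have hpre := (hfin w hw).preimage ((hq.injective_along f).injOn)
    rw [← Nat.cofinite_eq_atTop]
    filter_upwards [hpre.compl_mem_cofinite] with n hn
    by_contra hcon
    exact hn ⟨⟨_, rfl⟩, hcon⟩
  have hfreq := (hf ⟨w, hw⟩).and_eventually hev
  have hlen := length_initialList f
  constructor
  · refine Set.infinite_of_forall_exists_gt fun N => ?_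
    obtain ⟨n, hn, hlt, hsp⟩ := frequently_atTop.1 hfreq (N + 1)
    obtain ⟨i, h1, h2, h3, h4⟩ := (hh ⟨w, hw⟩ _ hsp).1
    rw [hlen] at h1
    exact ⟨i, ⟨h3, (hx n i ((h2.trans hlt).trans_le (le_max_right _ _))).2 h4⟩, by omega⟩
  · refine Set.infinite_of_forall_exists_gt fun N => ?_
    obtain ⟨n, hn, hlt, hsp⟩ := frequently_atTop.1 hfreq (N + 1)
    obtain ⟨i, h1, h2, h3, h4⟩ := (hh ⟨w, hw⟩ _ hsp).2
    rw [hlen] at h1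
    exact ⟨i, ⟨h3, fun h5 => h4 ((hx n i ((h2.trans hlt).trans_le (le_max_right _ _))).1 h5)⟩,
      by omega⟩

/-! ### Independent families -/

/-- The Boolean combination of the sets in `P` and of the complements of the sets in `N`. -/
def boolComb (P N : Finset (Set ℕ)) : Set ℕ :=
  {i | (∀ x ∈ P, i ∈ x) ∧ ∀ x ∈ N, i ∉ x}

/-- Independence, with the signs given by a pair of disjoint finite sets. -/
def IsIndep (A : Set (Set ℕ)) : Prop :=
  ∀ P N : Finset (Set ℕ), (P : Set (Set ℕ)) ⊆ A → (N : Set (Set ℕ)) ⊆ A → Disjoint P N →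
    (boolComb P N).Infinite

theorem IsIndep.isIndependentFamily {A : Set (Set ℕ)} (hA : IsIndep A) :
    IsIndependentFamily A := by
  classical
  intro F hF _ ν
  let P := (F.attach.filter fun x => ν x = true).image Subtype.val
  let N := (F.attach.filter fun x => ν x = false).image Subtype.val
  have hP : ∀ x, x ∈ P ↔ ∃ h : x ∈ F, ν ⟨x, h⟩ = true := by intro x; simp [P]
  have hN : ∀ x, x ∈ N ↔ ∃ h : x ∈ F, ν ⟨x, h⟩ = false := by intro x; simp [N]
  refine (hA P N (fun x hx => ?_) (fun x hx => ?_) ?_).mono ?_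
  · obtain ⟨h, _⟩ := (hP x).1 hx
    exact hF h
  · obtain ⟨h, _⟩ := (hN x).1 hx
    exact hF h
  · rw [Finset.disjoint_left]
    intro x h1 h2
    obtain ⟨_, h1⟩ := (hP x).1 h1
    obtain ⟨_, h2⟩ := (hN x).1 h2
    simp [h1] at h2
  · rintro i ⟨h1, h2⟩
    refine mem_iInter.2 fun x => ?_
    cases hx : ν x with
    | true => exact h1 _ ((hP _).2 ⟨x.2, hx⟩)
    | false => exact h2 _ ((hN _).2 ⟨x.2, hx⟩)

theorem IsIndep.mono {A B : Set (Set ℕ)} (hB : IsIndep B) (h : A ⊆ B) : IsIndep A :=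
  fun P N hP hN hPN => hB P N (hP.trans h) (hN.trans h) hPN

theorem isIndep_of_finite_subsets {A : Set (Set ℕ)}
    (h : ∀ F : Set (Set ℕ), F.Finite → F ⊆ A → IsIndep F) : IsIndep A :=
  fun P N hP hN hPN =>
    h (P ∪ N) (P.finite_toSet.union N.finite_toSet) (union_subset hP hN) P N
      subset_union_left subset_union_right hPN

theorem IsIndep.splits {A : Set (Set ℕ)} (hA : IsIndep A) {P N : Finset (Set ℕ)}
    (hP : (P : Set (Set ℕ)) ⊆ A) (hN : (N : Set (Set ℕ)) ⊆ A) (hPN : Disjoint P N) {x : Set ℕ}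
    (hx : x ∈ A) (hxP : x ∉ P) (hxN : x ∉ N) : Splits x (boolComb P N) := by
  classical
  constructor
  · refine (hA (insert x P) N ?_ hN ?_).mono ?_
    · rw [Finset.coe_insert]
      exact insert_subset hx hP
    · exact Finset.disjoint_insert_left.2 ⟨hxN, hPN⟩
    · rintro i ⟨h1, h2⟩
      exact ⟨⟨fun y hy => h1 y (Finset.mem_insert_of_mem hy), h2⟩,
        h1 x (Finset.mem_insert_self _ _)⟩
  · refine (hA P (insert x N) hP ?_ ?_).mono ?_
    · rw [Finset.coe_insert]
      exact insert_subset hx hN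
    · exact Finset.disjoint_insert_right.2 ⟨hxP, hPN⟩
    · rintro i ⟨h1, h2⟩
      exact ⟨⟨h1, fun y hy => h2 y (Finset.mem_insert_of_mem hy)⟩,
        h2 x (Finset.mem_insert_self _ _)⟩

/-- The Boolean combinations of finitely many members of `A`. -/
def boolCombs (A : Set (Set ℕ)) : Set (Set ℕ) :=
  {w | ∃ P N : Finset (Set ℕ), (P : Set (Set ℕ)) ⊆ A ∧ (N : Set (Set ℕ)) ⊆ A ∧ Disjoint P N ∧
    boolComb P N = w}

theorem isIndep_insert {A : Set (Set ℕ)} {x : Set ℕ}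
    (hx : ∀ w ∈ boolCombs A, Splits x w) : IsIndep (insert x A) := by
  classical
  intro P N hP hN hPN
  have hsub : ∀ F : Finset (Set ℕ), (F : Set (Set ℕ)) ⊆ insert x A →
      ((F.erase x : Finset (Set ℕ)) : Set (Set ℕ)) ⊆ A := fun F hF y hy => by
    obtain ⟨h1, h2⟩ := Finset.mem_erase.1 (Finset.mem_coe.1 hy)
    exact (hF h2).resolve_left h1
  have hdisj : Disjoint (P.erase x) (N.erase x) :=
    hPN.mono (Finset.erase_subset _ _) (Finset.erase_subset _ _)
  have hs := hx _ ⟨P.erase x, N.erase x, hsub P hP, hsub N hN, hdisj, rfl⟩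
  by_cases hxP : x ∈ P
  · refine hs.1.mono ?_
    rintro i ⟨⟨h1, h2⟩, h3⟩
    refine ⟨fun y hy => ?_, fun y hy => ?_⟩
    · by_cases e : y = x
      · exact e ▸ h3
      · exact h1 y (Finset.mem_erase.2 ⟨e, hy⟩)
    · exact h2 y (Finset.mem_erase.2
        ⟨fun e => Finset.disjoint_left.1 hPN hxP (e ▸ hy), hy⟩)
  · refine hs.2.mono ?_
    rintro i ⟨⟨h1, h2⟩, h3⟩
    refine ⟨fun y hy => ?_, fun y hy => ?_⟩
    · exact h1 y (Finset.mem_erase.2 ⟨fun e => hxP (e ▸ hy), hy⟩)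
    · by_cases e : y = x
      · exact e ▸ h3
      · exact h2 y (Finset.mem_erase.2 ⟨e, hy⟩)

theorem mk_boolCombs_lt {A : Set (Set ℕ)} (hA : Cardinal.mk A < Cardinal.continuum) :
    Cardinal.mk (boolCombs A) < Cardinal.continuum := by
  classical
  let g : List A × List A → Set ℕ := fun p =>
    boolComb (p.1.map Subtype.val).toFinset (p.2.map Subtype.val).toFinset
  have hlift : ∀ F : Finset (Set ℕ), (F : Set (Set ℕ)) ⊆ A →
      ∃ L : List A, (L.map Subtype.val).toFinset = F := fun F hF => by
    refine ⟨F.toList.attach.map fun a => ⟨a.1, hF (Finset.mem_toList.1 a.2)⟩, ?_⟩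
    ext y
    simp
  have hsub : boolCombs A ⊆ range g := by
    rintro w ⟨P, N, hP, hN, -, rfl⟩
    obtain ⟨L, rfl⟩ := hlift P hP
    obtain ⟨L', rfl⟩ := hlift N hN
    exact ⟨(L, L'), rfl⟩
  have hL : Cardinal.mk (List A) < Cardinal.continuum :=
    (Cardinal.mk_list_le_max A).trans_lt (max_lt Cardinal.aleph0_lt_continuum hA)
  refine (Cardinal.mk_le_mk_of_subset hsub).trans_lt (Cardinal.mk_range_le.trans_lt ?_)
  rw [Cardinal.mk_prod, Cardinal.lift_id]
  exact Cardinal.mul_lt_of_lt Cardinal.aleph0_le_continuum hL hL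

/-- By independence, a node can fail to split a Boolean combination only if it is one of the
finitely many sets used in it. -/
theorem IsScheme.exists_isBranch_isIndep (hd : dominatingNumber = Cardinal.continuum)
    {q : List ℕ → Set ℕ} {l : List ℕ → ℕ} (hq : IsScheme q l) {A : Set (Set ℕ)}
    (hA : IsIndep A) (hcard : Cardinal.mk A < Cardinal.continuum) (hqA : range q ⊆ A) :
    ∃ x, IsBranch q l x ∧ IsIndep (insert x A) := by
  classical
  obtain ⟨x, hx, hx'⟩ := hq.exists_isBranch_splits hd (mk_boolCombs_lt hcard) (by
    rintro w ⟨P, N, hP, hN, hPN, rfl⟩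
    refine (P ∪ N).finite_toSet.subset ?_
    rintro x ⟨hx, hns⟩
    by_contra hcon
    simp only [Finset.coe_union, mem_union, Finset.mem_coe, not_or] at hcon
    exact hns (hA.splits hP hN hPN (hqA hx) hcon.1 hcon.2))
  exact ⟨x, hx, isIndep_insert hx'⟩

/-- There is a countable independent family that is dense in `2 ^ ω`. -/
theorem exists_countable_dense_isIndep :
    ∃ A : Set (Set ℕ), A.Countable ∧ IsIndep A ∧ ∀ (x : Set ℕ) k, ∃ a ∈ A, AgreeBelow k a x := by
  classical
  let J := Finset ℕ × ℕ
  obtain ⟨e⟩ : Nonempty (ℕ ≃ Finset J) := ⟨(Denumerable.eqv (Finset J)).symm⟩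
  -- The part below `j.2` is prescribed for density; above it, `i` codes a finite set of indices.
  -- Independence holds because infinitely many finite sets contain the indices of `P` and avoid
  -- those of `N`.
  let a : J → Set ℕ := fun j => {i | if i < j.2 then i ∈ j.1 else j ∈ e i}
  refine ⟨range a, countable_range a, ?_, fun x k => ?_⟩
  · intro P N hP hN hPN
    choose! t ht using fun (y : Set ℕ) (hy : y ∈ range a) => hy
    have hdisj : ∀ y ∈ P, ∀ z ∈ N, t y ≠ t z := fun y hy z hz he =>
      Finset.disjoint_left.1 hPN hy (by
        have : y = z := by rw [← ht y (hP hy), he, ht z (hN hz)]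
        exact this ▸ hz)
    let K := (P ∪ N).sup fun y => (t y).2
    have hK : ∀ y, y ∈ P ∨ y ∈ N → (t y).2 ≤ K := fun y hy =>
      Finset.le_sup (f := fun y => (t y).2) (Finset.mem_union.2 hy)
    have hinf : {i | P.image t ⊆ e i ∧ Disjoint (N.image t) (e i)}.Infinite := by
      refine infinite_of_injOn_mapsTo (s := {m | m ∉ P.image t ∪ N.image t})
        (f := fun m => e.symm (insert m (P.image t))) ?_ ?_
        (Finset.finite_toSet (P.image t ∪ N.image t)).infinite_compl
      · intro m hm m' hm' h
        have h' := e.symm.injective h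
        have : m ∈ insert m' (P.image t) := h' ▸ Finset.mem_insert_self _ _
        exact (Finset.mem_insert.1 this).resolve_right
          fun h => hm (Finset.mem_union_left _ h)
      · intro m hm
        simp only [mem_ofPred_eq, Equiv.apply_symm_apply]
        refine ⟨Finset.subset_insert _ _, Finset.disjoint_insert_right.2
          ⟨fun h => hm (Finset.mem_union_right _ h), Finset.disjoint_left.2 fun z hz hz' => ?_⟩⟩
        obtain ⟨y, hy, rfl⟩ := Finset.mem_image.1 hz
        obtain ⟨y', hy', e'⟩ := Finset.mem_image.1 hz'
        exact hdisj y' hy' y hy e'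
    refine (hinf.sdiff (finite_Iio K)).mono ?_
    rintro i ⟨⟨h1, h2⟩, h3⟩
    have h3 : K ≤ i := not_lt.1 h3
    have hmem : ∀ y, y ∈ P ∨ y ∈ N → y ∈ range a → (i ∈ y ↔ t y ∈ e i) := fun y hy hya => by
      conv_lhs => rw [← ht y hya]
      simp [a, not_lt.2 ((hK y hy).trans h3)]
    refine ⟨fun y hy => (hmem y (Or.inl hy) (hP hy)).2 (h1 (Finset.mem_image_of_mem _ hy)),
      fun y hy hi => ?_⟩
    exact Finset.disjoint_left.1 h2 (Finset.mem_image_of_mem _ hy)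
      ((hmem y (Or.inr hy) (hN hy)).1 hi)
  · refine ⟨a ((Finset.range k).filter (· ∈ x), k), ⟨_, rfl⟩, fun i hi => ?_⟩
    simp [a, hi]

/-! ### The transfinite construction -/

theorem exists_isIndep_with_branches (hd : dominatingNumber = Cardinal.continuum) :
    ∃ A : Set (Set ℕ), IsIndep A ∧ (∀ (x : Set ℕ) k, ∃ a ∈ A, AgreeBelow k a x) ∧
      ∀ q l, IsScheme q l → range q ⊆ A → ∃ x ∈ A, IsBranch q l x := by
  classical
  obtain ⟨A₀, hcount, hind, hdense⟩ := exists_countable_dense_isIndep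
  obtain ⟨a₀, ha₀, -⟩ := hdense ∅ 0
  let T := Cardinal.continuum.{0}.ord.ToType
  have hT : Cardinal.mk ((List ℕ → Set ℕ) × (List ℕ → ℕ)) = Cardinal.mk T := by
    rw [Cardinal.mk_ord_toType]
    simp
  obtain ⟨e⟩ := Cardinal.eq.1 hT
  have : Nonempty T := ⟨e (fun _ => ∅, fun _ => 0)⟩
  let good : T → Set (Set ℕ) → Set ℕ → Prop := fun t B x =>
    -- The nodes need not lie in `B`, so each scheme is treated only once and no bookkeeping is
    -- needed.
    IsIndep (insert x B) ∧ IsBranch (e.symm t).1 (e.symm t).2 x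
  let g : T → Set ℕ := (wellFounded_lt (α := T)).fix fun t ih =>
    if h : ∃ x, good t (A₀ ∪ {y | ∃ (u : T) (hu : u < t), ih u hu = y}) x then h.choose else a₀
  have hg : ∀ t, g t = if h : ∃ x, good t (A₀ ∪ g '' Iio t) x then h.choose else a₀ := by
    intro t
    have hset : g '' Iio t = {y | ∃ (u : T) (_ : u < t), g u = y} := by
      ext y; simp
    rw [hset]
    exact WellFounded.fix_eq _ _ t
  have hstep : ∀ t, IsIndep (A₀ ∪ g '' Iio t) → IsIndep (A₀ ∪ g '' Iic t) := by
    intro t ht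
    have : A₀ ∪ g '' Iic t = insert (g t) (A₀ ∪ g '' Iio t) := by
      rw [← Iio_insert, image_insert_eq, union_insert]
    rw [this]
    by_cases h : ∃ x, good t (A₀ ∪ g '' Iio t) x
    · rw [hg t, dif_pos h]
      exact h.choose_spec.1
    · rw [hg t, dif_neg h, insert_eq_of_mem (mem_union_left _ ha₀)]
      exact ht
  have hunion : ∀ S : Set T, (∀ t ∈ S, IsIndep (A₀ ∪ g '' Iic t)) → IsIndep (A₀ ∪ g '' S) := by
    intro S hS
    refine isIndep_of_finite_subsets fun F hF hFS => ?_
    -- Independence is finitary, and finitely many stages all lie below their largest one.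
    obtain ⟨S', hS', hfin, hFS'⟩ : ∃ S' ⊆ S, S'.Finite ∧ F ⊆ A₀ ∪ g '' S' := by
      have hfin : (F \ A₀).Finite := hF.sdiff
      choose! p hp using fun y (hy : y ∈ F \ A₀) => (hFS hy.1).resolve_left hy.2
      refine ⟨p '' (F \ A₀), image_subset_iff.2 fun y hy => (hp y hy).1, hfin.image p,
        fun y hy => ?_⟩
      by_cases hy0 : y ∈ A₀
      · exact Or.inl hy0
      · exact Or.inr ⟨p y, mem_image_of_mem p ⟨hy, hy0⟩, (hp y ⟨hy, hy0⟩).2⟩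
    rcases S'.eq_empty_or_nonempty with rfl | hne
    · exact hind.mono (by simpa using hFS')
    · obtain ⟨m, hm, hmax⟩ := hfin.exists_maximal hne
      refine (hS m (hS' hm)).mono (hFS'.trans (union_subset_union_right _ (image_mono ?_)))
      intro u hu
      exact le_of_not_gt fun hlt => absurd (hmax hu hlt.le) (not_le.2 hlt)
  have hall : ∀ t, IsIndep (A₀ ∪ g '' Iic t) := by
    intro t
    induction t using WellFoundedLT.induction with
    | _ t ih => exact hstep t (hunion _ fun u hu => ih u hu)
  have hA : IsIndep (A₀ ∪ range g) := by
    rw [← image_univ]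
    exact hunion univ fun t _ => hall t
  refine ⟨A₀ ∪ range g, hA, fun x k => ?_, fun q l hq hqA => ?_⟩
  · obtain ⟨a, ha, hk⟩ := hdense x k
    exact ⟨a, Or.inl ha, hk⟩
  · let t := e (q, l)
    -- The nodes may enter only after stage `t`. Adjoining them to the stage keeps it independent,
    -- as a subfamily of the final family, so a suitable branch was available at stage `t`.
    have hB : A₀ ∪ g '' Iio t ∪ range q ⊆ A₀ ∪ range g :=
      union_subset (union_subset_union_right _ (image_subset_range _ _)) hqA
    have hcard : Cardinal.mk (A₀ ∪ g '' Iio t ∪ range q : Set (Set ℕ)) < Cardinal.continuum := by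
      have hc : ∀ {C : Set (Set ℕ)}, C.Countable → Cardinal.mk C < Cardinal.continuum :=
        fun hC => (Cardinal.le_aleph0_iff_set_countable.2 hC).trans_lt Cardinal.aleph0_lt_continuum
      have hadd := fun {a b : Cardinal.{0}} (ha : a < Cardinal.continuum) (hb : b < _) =>
        Cardinal.add_lt_of_lt Cardinal.aleph0_le_continuum ha hb
      refine (Cardinal.mk_union_le _ _).trans_lt (hadd ((Cardinal.mk_union_le _ _).trans_lt
        (hadd (hc hcount) ?_)) (hc (countable_range q)))
      exact Cardinal.mk_image_le.trans_lt (Cardinal.mk_Iio_toType_ord_lt t)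
    obtain ⟨x, hx, hxi⟩ := hq.exists_isBranch_isIndep hd (hA.mono hB) hcard subset_union_right
    have h : ∃ x, good t (A₀ ∪ g '' Iio t) x :=
      ⟨x, hxi.mono (insert_subset_insert subset_union_left), by simpa [t] using hx⟩
    refine ⟨g t, Or.inr ⟨t, rfl⟩, ?_⟩
    have := h.choose_spec.2
    rw [hg t, dif_pos h]
    simpa [t] using this

/-! ### Branches and the Baire property -/

theorem charFun_eq_iff {x y : Set ℕ} {i : ℕ} : charFun x i = charFun y i ↔ (i ∈ x ↔ i ∈ y) := by
  simp [charFun]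

theorem isOpen_setOf_agreeBelow (x : Set ℕ) (k : ℕ) :
    IsOpen {z : ℕ → Bool | ∀ i < k, z i = charFun x i} := by
  have : {z : ℕ → Bool | ∀ i < k, z i = charFun x i} = PiNat.cylinder (charFun x) k := rfl
  rw [this]
  exact PiNat.isOpen_cylinder _ _ _

theorem exists_cylinder_subset {O : Set (ℕ → Bool)} (hO : IsOpen O) {z : ℕ → Bool} (hz : z ∈ O) :
    ∃ k, ∀ y : ℕ → Bool, (∀ i < k, y i = z i) → y ∈ O := by
  obtain ⟨_, ⟨x, k, rfl⟩, hzk, hsub⟩ :=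
    (PiNat.isTopologicalBasis_cylinders (fun _ : ℕ => Bool)).exists_subset_of_mem_open hz hO
  exact ⟨k, fun y hy => hsub fun i hi => (hy i hi).trans (hzk i hi)⟩

theorem isCompletelyBaire_of_branches {A : Set (Set ℕ)}
    (hA : ∀ q l, IsScheme q l → range q ⊆ A → ∃ x ∈ A, IsBranch q l x) :
    IsCompletelyBaire (charFun '' A : Set (ℕ → Bool)) := by
  classical
  intro C hC
  refine ⟨fun U hU hUd => ?_⟩
  rw [dense_iff_inter_open]
  rintro V hV ⟨v, hv⟩
  by_contra hcon
  have hempty : ∀ c ∈ V, ∃ n, c ∉ U n := fun c hc => by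
    by_contra h
    push Not at h
    exact hcon ⟨c, hc, mem_iInter.2 h⟩
  let φ : C → Set ℕ := fun c => {i | c.1.1 i = true}
  have hφ : ∀ c : C, charFun (φ c) = c.1.1 := fun c => by
    funext i; simp [charFun, φ]
  have hφA : ∀ c, φ c ∈ A := fun c => by
    obtain ⟨a, ha, hac⟩ := c.1.2
    have : φ c = a := by
      ext i; simp [φ, ← hac, charFun]
    exact this ▸ ha
  have hinj : ∀ c c' : C, φ c = φ c' → c = c' := fun c c' h => by
    apply Subtype.ext; apply Subtype.ext
    rw [← hφ, ← hφ, h]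
  have hball : ∀ (c : C) k, IsOpen {c' : C | AgreeBelow k (φ c') (φ c)} := fun c k => by
    convert (isOpen_setOf_agreeBelow (φ c) k).preimage
      (continuous_subtype_val.comp (continuous_subtype_val (p := (· ∈ C)))) using 1
    ext c'
    simp only [mem_ofPred_eq, mem_preimage, Function.comp_apply, ← hφ c', charFun_eq_iff]
    rfl
  have hbasis : ∀ (O : Set C), IsOpen O → ∀ c ∈ O, ∃ k, ∀ c' : C, AgreeBelow k (φ c') (φ c) →
      c' ∈ O := by
    intro O hO c hc
    obtain ⟨O₁, hO₁, rfl⟩ := isOpen_induced_iff.1 hO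
    obtain ⟨O₂, hO₂, rfl⟩ := isOpen_induced_iff.1 hO₁
    obtain ⟨k, hk⟩ := exists_cylinder_subset hO₂ hc
    refine ⟨k, fun c' h => hk _ fun i hi => ?_⟩
    rw [← hφ c', ← hφ c]
    exact charFun_eq_iff.2 (h i hi)
  -- One extension step of the scheme.
  have hstep : ∀ (c : C) (r n : ℕ), ∃ (c' : C) (r' : ℕ),
      (∀ d : C, AgreeBelow r (φ d) (φ c) → d ∈ V) →
        AgreeBelow r (φ c') (φ c) ∧ ¬ AgreeBelow r' (φ c') (φ c) ∧ r < r' ∧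
          ∀ d : C, AgreeBelow r' (φ d) (φ c') → d ∈ U n := by
    intro c r n
    by_cases hcV : ∀ d : C, AgreeBelow r (φ d) (φ c) → d ∈ V
    swap
    · exact ⟨c, r, fun h => absurd h hcV⟩
    -- An isolated point would belong to every dense `U m`, but each point of `V` misses some `U m`.
    have hne : ({c' : C | AgreeBelow r (φ c') (φ c)} ∩ {c}ᶜ).Nonempty := by
      by_contra h
      have hsingle : {c' : C | AgreeBelow r (φ c') (φ c)} = {c} := by
        refine Subset.antisymm (fun d hd => ?_) ?_
        · by_contra hdc
          exact h ⟨d, hd, hdc⟩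
        · rintro _ rfl i _
          exact Iff.rfl
      have hopen : IsOpen {c} := hsingle ▸ hball c r
      obtain ⟨m, hm⟩ := hempty c (hcV c fun _ _ => Iff.rfl)
      obtain ⟨d, hd, hdU⟩ := (hUd m).inter_open_nonempty _ hopen ⟨c, rfl⟩
      exact hm (hd ▸ hdU)
    obtain ⟨c', ⟨hc1, hc2⟩, hc3⟩ := (hUd n).inter_open_nonempty _
      ((hball c r).inter isOpen_compl_singleton) hne
    obtain ⟨k, hk⟩ := hbasis _ (hU n) c' hc3
    obtain ⟨j, hj⟩ : ∃ j, ¬ (j ∈ φ c' ↔ j ∈ φ c) := by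
      by_contra h
      push Not at h
      exact hc2 (hinj _ _ (Set.ext h))
    -- The new level exceeds `r`, the radius `k` of a ball inside `U n`, and a place `j` where `c'`
    -- differs from `c`.
    exact ⟨c', r + k + j + 1, fun _ => ⟨hc1, fun h => hj (h j (by omega)), by omega,
      fun d hd => hk d (hd.mono (by omega))⟩⟩
  choose nx lv hnx using hstep
  obtain ⟨k₀, hk₀⟩ := hbasis V hV v hv
  -- Using the radius `max p.2 k` makes the successors converge; the length of `s` selects which `U
  -- n` to enter.
  let st : List ℕ → C × ℕ := fun s => List.rec (v, k₀)
    (fun k s p => (nx p.1 (max p.2 k) s.length, lv p.1 (max p.2 k) s.length)) s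
  have hst : ∀ k s, st (k :: s) = (nx (st s).1 (max (st s).2 k) s.length,
    lv (st s).1 (max (st s).2 k) s.length) := fun k s => rfl
  have hstV : ∀ s, ∀ d : C, AgreeBelow (st s).2 (φ d) (φ (st s).1) → d ∈ V := by
    intro s
    induction s with
    | nil => exact hk₀
    | cons k s ih =>
      intro d hd
      obtain ⟨h1, -, h3, -⟩ := hnx (st s).1 (max (st s).2 k) s.length
        fun d hd => ih d (hd.mono (le_max_left _ _))
      rw [hst] at hd
      exact ih d (((hd.mono h3.le).trans h1).mono (le_max_left _ _))
  have hspec := fun k s => hnx (st s).1 (max (st s).2 k) s.length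
    fun d hd => hstV s d (hd.mono (le_max_left _ _))
  have hq : IsScheme (fun s => φ (st s).1) fun s => (st s).2 :=
    ⟨fun s k => (hspec k s).1, fun s k => (hspec k s).2.1, fun s k => (hspec k s).2.2.1⟩
  obtain ⟨x, hxA, f, hf⟩ := hA _ _ hq (range_subset_iff.2 fun s => hφA _)
  let y : (charFun '' A : Set (ℕ → Bool)) := ⟨charFun x, x, hxA, rfl⟩
  have hyC : y ∈ C := by
    rw [← hC.closure_eq, mem_closure_iff]
    intro O hO hyO
    obtain ⟨O', hO', rfl⟩ := isOpen_induced_iff.1 hO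
    obtain ⟨k, hk⟩ := exists_cylinder_subset hO' hyO
    refine ⟨(st (initialList f k)).1.1, hk _ fun i hi => ?_, (st (initialList f k)).1.2⟩
    rw [← hφ]
    exact charFun_eq_iff.2
      ((hf k i (hi.trans_le ((hq.le_level f k).trans (le_max_left _ _)))).symm)
  have hφy : φ ⟨y, hyC⟩ = x := by
    ext i; simp [φ, y, charFun]
  -- The root's ball puts the branch in `V`, so it misses some `U n`; the ball of its node of length
  -- `n + 1` puts it in `U n`.
  obtain ⟨n, hn⟩ := hempty ⟨y, hyC⟩ (hk₀ _ (by
    rw [hφy]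
    exact (hf 0).mono (le_max_left _ _)))
  refine hn ?_
  have h := (hspec (f n) (initialList f n)).2.2.2
  rw [length_initialList] at h
  refine h _ ?_
  rw [hφy]
  have h' := (hf (n + 1)).mono (le_max_left _ _)
  simpa only [initialList, hst, length_initialList] using h'

theorem theorem6p3 (h : dominatingNumber = Cardinal.continuum) :
    ∃ A : Set (Set ℕ), IsIndependentFamily A ∧
      Dense (charFun '' A : Set (ℕ → Bool)) ∧
      IsCompletelyBaire (charFun '' A : Set (ℕ → Bool)) := by
  obtain ⟨A, hA, hdense, hbranch⟩ := exists_isIndep_with_branches h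
  refine ⟨A, hA.isIndependentFamily, ?_, isCompletelyBaire_of_branches hbranch⟩
  rw [dense_iff_inter_open]
  rintro O hO ⟨z, hz⟩
  obtain ⟨k, hk⟩ := exists_cylinder_subset hO hz
  obtain ⟨a, ha, hak⟩ := hdense {i | z i = true} k
  refine ⟨charFun a, hk _ fun i hi => ?_, a, ha, rfl⟩
  have := hak i hi
  rw [mem_ofPred_eq] at this
  rw [Bool.eq_iff_iff, ← this]
  simp [charFun]
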